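/- Let $\mathcal A=(Q,\Sigma,\delta,\rho)$ be a Mealy automaton: $Q,\Sigma$ are non-empty finite sets, with maps $\delta_i:Q\to Q$ ($i\in\Sigma$) and $\rho_x:\Sigma\to\Sigma$ ($x\in Q$). Assume that $\#Q=3$ and that $\mathcal A$ is invertible and reversible, i.e. all $\rho_x$ and all $\delta_i$ are permutations. Extend $\rho_x$ to $\Sigma^*$ by $\rho_x(is)=\rho_x(i)\rho_{\delta_i(x)}(s)$ and $\delta_i$ to $Q^*$ by $\delta_i(xu)=\delta_i(x)\delta_{\rho_x(i)}(u)$ (fixing the empty word). A word $u=x_1\cdots x_n\in Q^+$ induces the action $\rho_u=\rho_{x_n}\circ\cdots\circ\rho_{x_1}$ on $\Sigma^*$. The connected components of $\mathcal A^n$ are those of the graph on $Q^n$ with edges $u\to\delta_i(u)$, $i\in\Sigma$. The orbit tree has the connected components of the powers $\mathcal A^n$, $n\ge 0$, as vertices; the component of $u\in Q^n$ (a vertex at level $n$) is joined to the component of $ux$ for each $x\in Q$ by an edge (an edge at level $n$), labeled by the ratio of the size of the latter component to the size of the former. A 2-block is a maximal (possibly infinite) factor all of whose letters are $2$ in the label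 sequence of an infinite path starting at the root. Let $d$ be the connection degree of $\mathcal A$, i.e. the largest $n$ such that $\mathcal A^n$ is connected. Assume that $0<d<\infty$ and that there are exactly two edges at level $d$; then one is labeled by $1$ and the other, called $e_2$, by $2$. An edge $e$ is liftable to an edge $f$ if each word of the lower component of $e$ has a suffix in the lower component of $f$. A word over $Q$ is orbital if, in the path of the orbit tree through the components of its prefixes, every edge at a level $\ge d$ is liftable to $e_2$ (equivalently, all its factors of length $d+1$ belong to the lower component of $e_2$). A word is cyclically orbital if all its powers are orbital. Proposition. There is a function $K:\mathbb N\to\mathbb N$ such that, for all $\mathcal A$ and $d$ as above: if the lengths of the 2-blocks in the orbit tree of $\mathcal A$ are bounded, then for every non-empty word $u$ over $Q$ there are an integer $k$ with $1\le k\le K(d)$ and a non-empty cyclically orbital word $v$ with $\rho_{u^k}=\rho_v$. -/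

import Mathlib

/-- A Mealy automaton with stateset `Q` and alphabet `S`: transition functions `δ i : Q → Q` and
output functions `ρ x : S → S`. -/
structure MealyAutomaton (Q : Type*) (S : Type*) where
  δ : S → Q → Q
  ρ : Q → S → S

namespace MealyAutomaton

variable {Q : Type*} {S : Type*}

/-- The dual automaton: states and letters exchange their roles. -/
def dual (M : MealyAutomaton Q S) : MealyAutomaton S Q where
  δ := M.ρ
  ρ := M.δ

/-- Every output function is a permutation of the alphabet. -/
def Invertible (M : MealyAutomaton Q S) : Prop := ∀ x, Function.Bijective (M.ρ x)

/-- Every transition function is a permutation of the stateset. -/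
def Reversible (M : MealyAutomaton Q S) : Prop := ∀ i, Function.Bijective (M.δ i)

/-- The production function `ρ_x : S* → S*` of a state `x`:
`ρ_x (i s) = ρ_x (i) ρ_{δ_i (x)} (s)`. -/
def production (M : MealyAutomaton Q S) : Q → List S → List S
  | _, [] => []
  | x, i :: s => M.ρ x i :: M.production (M.δ i x) s

/-- The action `ρ_u : S* → S*` induced by a word `u = x₁ ⋯ xₙ` over the stateset:
`ρ_u = ρ_{xₙ} ∘ ⋯ ∘ ρ_{x₁}`. -/
def action (M : MealyAutomaton Q S) : List Q → List S → List S
  | [], s => s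
  | x :: u, s => M.action u (M.production x s)

/-- There is a transition from the state `u` to the state `v` in the `n`-th power of `M`, where `n`
is the length of `u`: some letter `i` satisfies `δ_i (u) = v`. Here `δ_i : Q* → Q*` is the
production function of `i` in the dual automaton; it preserves the length. -/
def PowerStep (M : MealyAutomaton Q S) (u v : List Q) : Prop :=
  ∃ i : S, M.dual.production i u = v

/-- The (set of states of the) connected component of the word `u` in the underlying graph of the
power of `M` whose states are the words of the length of `u`. -/
def component (M : MealyAutomaton Q S) (u : List Q) : Set (List Q) :=
  {v | Relation.EqvGen M.PowerStep u v}

/-- The `n`-th power of `M` is connected. -/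
def PowerConnected (M : MealyAutomaton Q S) (n : ℕ) : Prop :=
  ∀ u v : List Q, u.length = n → v.length = n → v ∈ M.component u

/-- The connection degree: the largest `n` such that the `n`-th power is connected, and `⊤` if
there are arbitrarily large such `n`. -/
noncomputable def connectionDegree (M : MealyAutomaton Q S) : ℕ∞ :=
  ⨆ n ∈ {n : ℕ | M.PowerConnected n}, (n : ℕ∞)

/-- An edge of the orbit tree of the dual of `M`. It joins the connected component of a word `u` of
length `level` to the connected component of a word `u x` with `x ∈ Q`. -/
structure Edge (M : MealyAutomaton Q S) where
  level : ℕ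
  top : Set (List Q)
  bot : Set (List Q)
  isEdge : ∃ (u : List Q) (x : Q),
    u.length = level ∧ top = M.component u ∧ bot = M.component (u ++ [x])

/-- The label of an edge: the size of its lower component divided by the size of its upper
component. For a reversible automaton with a finite stateset the division is exact. -/
noncomputable def Edge.label {M : MealyAutomaton Q S} (e : M.Edge) : ℕ :=
  e.bot.ncard / e.top.ncard

/-- The edge `e` is liftable to the edge `f`: each word of the lower component of `e` has a suffix
in the lower component of `f`. -/
def Edge.LiftableTo {M : MealyAutomaton Q S} (e f : M.Edge) : Prop :=
  ∀ v ∈ e.bot, ∃ w ∈ f.bot, w <:+ v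

/-- The edge of the orbit tree from the component of `u` to the component of `u x`. -/
def edge (M : MealyAutomaton Q S) (u : List Q) (x : Q) : M.Edge where
  level := u.length
  top := M.component u
  bot := M.component (u ++ [x])
  isEdge := ⟨u, x, rfl, rfl, rfl⟩

/-- The path of the orbit tree that starts at the component of `u` and reads the word `w`. -/
def pathFrom (M : MealyAutomaton Q S) : List Q → List Q → List M.Edge
  | _, [] => []
  | u, x :: w => M.edge u x :: M.pathFrom (u ++ [x]) w

/-- The path of the word `w` in the orbit tree: the initial path through the components of the
prefixes of `w`. -/
def path (M : MealyAutomaton Q S) (w : List Q) : List M.Edge := M.pathFrom [] w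

/-- An infinite initial path of the orbit tree. -/
def IsBranch (M : MealyAutomaton Q S) (b : ℕ → M.Edge) : Prop :=
  ∀ n, (b n).level = n ∧ (b n).bot = (b (n + 1)).top

/-- The factor of length `ℓ` (possibly infinite) at position `p` of the infinite word `w` is a
`j`-block: a maximal factor all of whose letters are `j`. -/
def IsBlock {F : Type*} (w : ℕ → F) (j : F) (p : ℕ) (ℓ : ℕ∞) : Prop :=
  (∀ i : ℕ, p ≤ i → (i : ℕ∞) < p + ℓ → w i = j) ∧
  (0 < p → w (p - 1) ≠ j) ∧
  (∀ q : ℕ, (q : ℕ∞) = p + ℓ → w q ≠ j)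

/-- The lengths of the 2-blocks in the labeled orbit tree are bounded. -/
def TwoBlocksBounded (M : MealyAutomaton Q S) : Prop :=
  ∃ N : ℕ, ∀ b : ℕ → M.Edge, M.IsBranch b →
    ∀ (p : ℕ) (ℓ : ℕ∞), IsBlock (fun n => (b n).label) 2 p ℓ → ℓ ≤ N

/-- The edges of the orbit tree whose level is the connection degree. -/
def splittingEdges (M : MealyAutomaton Q S) : Set M.Edge :=
  {e | (e.level : ℕ∞) = M.connectionDegree}

/-- `e` is the reduction edge: the edge labeled by 2 at the level of the connection degree. -/
def IsReductionEdge (M : MealyAutomaton Q S) (e : M.Edge) : Prop :=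
  e ∈ M.splittingEdges ∧ e.label = 2

/-- The word `u` is orbital: every edge of its path, at the level of the connection degree or
further from the root, is liftable to the reduction edge. -/
def IsOrbital (M : MealyAutomaton Q S) (u : List Q) : Prop :=
  ∀ e ∈ M.path u, M.connectionDegree ≤ e.level →
    ∃ e₂ : M.Edge, M.IsReductionEdge e₂ ∧ e.LiftableTo e₂

/-- The `k`-th power of a word. -/
def wordPow {F : Type*} (u : List F) (k : ℕ) : List F := (List.replicate k u).flatten

/-- All powers of the word `u` are orbital. -/
def IsCyclicallyOrbital (M : MealyAutomaton Q S) (u : List Q) : Prop :=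
  ∀ k : ℕ, M.IsOrbital (wordPow u k)

end MealyAutomaton

/-! Already `K = 1` works. Call a word good when all its factors of length `d + 1` lie in the lower
component of `e₂`. Goodness is constant on components, and a good word has at most one bad
one-letter extension on either side (`splitsAt`). As there are three letters, any two good words
share a good extension, and any two words of length `d` are the two ends of some good word
(`SplitsAt.reaches`).

Bounded 2-blocks force rigidity (`exists_rigidAt`): beyond some length, a good word is determined by
its component and a proper prefix. Otherwise the good words of each length would form a single
component, and a branch through them would carry the label 2 forever. If all powers of `w` are good,
rigidity makes every word in the component of such a power depend only on a prefix of bounded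
length. Pigeonhole then gives `w` finite order (`RigidAt.exists_action_wordPow_eq_id`).

Hence there are good words with trivial action and prescribed ends. Padding each letter of `u` with
them keeps the action and makes all junctions good, so all powers of the padded word are good
(`SplitsAt.exists_cyclically_good`). -/

namespace MealyAutomaton

/-! ### Actions on letters and on words -/

variable {Q : Type*} {S : Type*} {M : MealyAutomaton Q S}

/-- The permutation of the alphabet induced by a word over the stateset. -/
def letterAction (M : MealyAutomaton Q S) (u : List Q) (i : S) : S :=
  u.foldl (fun j x => M.ρ x j) i

theorem dual_production_append (u v : List Q) (i : S) :
    M.dual.production i (u ++ v) =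
      M.dual.production i u ++ M.dual.production (M.letterAction u i) v := by
  induction u generalizing i with
  | nil => rfl
  | cons x u ih =>
    change _ :: M.dual.production (M.ρ x i) (u ++ v) = _
    rw [ih]
    rfl

theorem length_dual_production (u : List Q) (i : S) :
    (M.dual.production i u).length = u.length := by
  induction u generalizing i with
  | nil => rfl
  | cons x u ih =>
    change (_ :: M.dual.production (M.ρ x i) u).length = _
    simp [ih]

theorem dual_production_injective (hr : M.Reversible) (i : S) :
    Function.Injective (M.dual.production i) := by
  intro u
  induction u generalizing i with
  | nil =>
    intro v h
    have := congrArg List.length h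
    simp only [length_dual_production, List.length_nil] at this
    exact (List.length_eq_zero_iff.1 this.symm).symm
  | cons x u ih =>
    intro v h
    cases v with
    | nil =>
      have := congrArg List.length h
      simp [length_dual_production] at this
    | cons y v =>
      change M.δ i x :: M.dual.production (M.ρ x i) u =
        M.δ i y :: M.dual.production (M.ρ y i) v at h
      obtain ⟨h1, h2⟩ := List.cons.inj h
      obtain rfl := (hr i).injective h1
      rw [ih _ h2]

theorem letterAction_bijective (hi : M.Invertible) (u : List Q) :
    Function.Bijective (M.letterAction u) := by
  induction u with
  | nil => exact Function.bijective_id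
  | cons x u ih => exact ih.comp (hi x)

theorem action_nil (u : List Q) : M.action u [] = [] := by
  induction u with
  | nil => rfl
  | cons x u ih => exact ih

theorem action_cons (u : List Q) (i : S) (s : List S) :
    M.action u (i :: s) = M.letterAction u i :: M.action (M.dual.production i u) s := by
  induction u generalizing i s with
  | nil => rfl
  | cons x u ih => exact ih _ _

theorem action_append (u v : List Q) : M.action (u ++ v) = M.action v ∘ M.action u := by
  induction u with
  | nil => rfl
  | cons x u ih =>
    funext s
    change M.action (u ++ v) _ = _
    rw [ih]
    rfl

theorem action_surjective (hi : M.Invertible) (u : List Q) :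
    Function.Surjective (M.action u) := by
  intro t
  induction t generalizing u with
  | nil => exact ⟨[], action_nil u⟩
  | cons j t ih =>
    obtain ⟨i, rfl⟩ := (letterAction_bijective hi u).surjective j
    obtain ⟨s, rfl⟩ := ih (M.dual.production i u)
    exact ⟨i :: s, action_cons u i s⟩

theorem finite_words [Finite Q] (n : ℕ) : Finite {l : List Q // l.length = n} :=
  (List.finite_length_eq Q n).to_subtype

/-! ### Connected components -/

theorem mem_component_self (u : List Q) : u ∈ M.component u := Relation.EqvGen.refl u

theorem mem_component_symm {u v : List Q} (h : v ∈ M.component u) : u ∈ M.component v :=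
  Relation.EqvGen.symm _ _ h

theorem mem_component_trans {u v w : List Q} (h : v ∈ M.component u) (h' : w ∈ M.component v) :
    w ∈ M.component u := Relation.EqvGen.trans _ _ _ h h'

theorem component_eq {u v : List Q} (h : v ∈ M.component u) : M.component v = M.component u :=
  Set.ext fun _ => ⟨mem_component_trans h, mem_component_trans (mem_component_symm h)⟩

theorem dual_production_mem_component (u : List Q) (i : S) :
    M.dual.production i u ∈ M.component u := Relation.EqvGen.rel _ _ ⟨i, rfl⟩

@[elab_as_elim]
theorem component_induction {p : ∀ u v : List Q, v ∈ M.component u → Prop}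
    (step : ∀ u i, p u (M.dual.production i u) (dual_production_mem_component u i))
    (refl : ∀ u, p u u (mem_component_self u))
    (symm : ∀ u v h, p u v h → p v u (mem_component_symm h))
    (trans : ∀ u v w h h', p u v h → p v w h' → p u w (mem_component_trans h h'))
    {u v : List Q} (h : v ∈ M.component u) : p u v h := by
  have h' : Relation.EqvGen M.PowerStep u v := h
  induction h' with
  | rel u v h' =>
    obtain ⟨i, rfl⟩ := h'
    exact step u i
  | refl u => exact refl u
  | symm u v h' ih => exact symm _ _ h' (ih h')
  | trans u v w h' h'' ih ih' => exact trans _ _ _ h' h'' (ih h') (ih' h'')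

theorem mem_component_of_reflTransGen {u v : List Q}
    (h : Relation.ReflTransGen M.PowerStep u v) : v ∈ M.component u := by
  induction h with
  | refl => exact mem_component_self u
  | tail _ h ih => exact mem_component_trans ih (Relation.EqvGen.rel _ _ h)

theorem length_eq_of_mem_component {u v : List Q} (h : v ∈ M.component u) :
    v.length = u.length := by
  induction h using component_induction with
  | step u i =>
    exact length_dual_production u i
  | refl u => rfl
  | symm u v _ ih => exact ih.symm
  | trans u v w _ _ ih ih' => exact ih'.trans ih

theorem take_mem_component {u v : List Q} (h : v ∈ M.component u) (k : ℕ) :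
    v.take k ∈ M.component (u.take k) := by
  induction h using component_induction with
  | step u i =>
    have : (M.dual.production i u).take k = M.dual.production i (u.take k) := by
      conv_lhs => rw [← List.take_append_drop k u, dual_production_append]
      by_cases hk : k ≤ u.length
      · exact List.take_left' (by simp [length_dual_production, hk])
      · push Not at hk
        rw [List.drop_of_length_le hk.le]
        change List.take k (_ ++ []) = _
        rw [List.append_nil]
        exact List.take_of_length_le (by simp [length_dual_production])
    rw [this]
    exact dual_production_mem_component _ _
  | refl u => exact mem_component_self _
  | symm u v _ ih => exact mem_component_symm ih
  | trans u v w _ _ ih ih' => exact mem_component_trans ih ih'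

theorem drop_mem_component {u v : List Q} (h : v ∈ M.component u) (k : ℕ) :
    v.drop k ∈ M.component (u.drop k) := by
  induction h using component_induction with
  | step u i =>
    have : (M.dual.production i u).drop k =
        M.dual.production (M.letterAction (u.take k) i) (u.drop k) := by
      conv_lhs => rw [← List.take_append_drop k u, dual_production_append]
      by_cases hk : k ≤ u.length
      · exact List.drop_left' (by simp [length_dual_production, hk])
      · push Not at hk
        rw [List.drop_of_length_le hk.le]
        change List.drop k (_ ++ []) = []
        exact List.drop_of_length_le (by simp [length_dual_production, hk.le])
    rw [this]
    exact dual_production_mem_component _ _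
  | refl u => exact mem_component_self _
  | symm u v _ ih => exact mem_component_symm ih
  | trans u v w _ _ ih ih' => exact mem_component_trans ih ih'

theorem left_mem_component {a b s t : List Q} (hl : a.length = b.length)
    (h : a ++ s ∈ M.component (b ++ t)) : a ∈ M.component b := by
  have := take_mem_component h a.length
  rwa [List.take_left' rfl, List.take_left' hl.symm] at this

theorem right_mem_component {a b s t : List Q} (hl : a.length = b.length)
    (h : a ++ s ∈ M.component (b ++ t)) : s ∈ M.component t := by
  have := drop_mem_component h a.length
  rwa [List.drop_left' rfl, List.drop_left' hl.symm] at this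

/-- A letter permutes the finite set of words of a given length, so a step is undone by iterating
it. Components are thus strongly connected, and facts can be transported along forward steps only.
-/
theorem reflTransGen_of_mem_component [Finite Q] (hr : M.Reversible) {u v : List Q}
    (h : v ∈ M.component u) : Relation.ReflTransGen M.PowerStep u v := by
  have back : ∀ (u : List Q) (i : S),
      Relation.ReflTransGen M.PowerStep (M.dual.production i u) u := by
    intro u i
    have := finite_words (Q := Q) u.length
    let f : {l : List Q // l.length = u.length} → {l : List Q // l.length = u.length} :=
      fun l => ⟨M.dual.production i l, (length_dual_production _ _).trans l.2⟩
    have hf : Function.Injective f := fun a b hab =>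
      Subtype.ext (dual_production_injective hr i (congrArg Subtype.val hab))
    obtain ⟨n, hn, hp⟩ := Function.mem_periodicPts.1 (hf.mem_periodicPts ⟨u, rfl⟩)
    have key : ∀ (m : ℕ) (l : {l : List Q // l.length = u.length}),
        Relation.ReflTransGen M.PowerStep l.1 (f^[m] l).1 := by
      intro m
      induction m with
      | zero => exact fun l => .refl
      | succ m ih => exact fun l => .head ⟨i, rfl⟩ (ih (f l))
    have h1 := key (n - 1) (f ⟨u, rfl⟩)
    rw [← Function.iterate_succ_apply, Nat.succ_eq_add_one, Nat.sub_add_cancel hn, hp.eq] at h1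
    exact h1
  have symm : ∀ {u v : List Q}, Relation.ReflTransGen M.PowerStep u v →
      Relation.ReflTransGen M.PowerStep v u := by
    intro u v h
    induction h with
    | refl => exact .refl
    | tail _ h ih =>
      obtain ⟨i, rfl⟩ := h
      exact (back _ i).trans ih
  induction h using component_induction with
  | step u i => exact .single ⟨i, rfl⟩
  | refl u => exact .refl
  | symm u v _ ih => exact symm ih
  | trans u v w _ _ ih ih' => exact ih.trans ih'

theorem exists_append_right_mem_component [Finite Q] (hr : M.Reversible) {u v : List Q}
    (h : v ∈ M.component u) (t : List Q) :
    ∃ t', t'.length = t.length ∧ v ++ t' ∈ M.component (u ++ t) := by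
  induction reflTransGen_of_mem_component hr h with
  | refl => exact ⟨t, rfl, mem_component_self _⟩
  | @tail b c h1 h2 ih =>
    obtain ⟨i, rfl⟩ := h2
    obtain ⟨t', ht, h3⟩ := ih (mem_component_of_reflTransGen h1)
    refine ⟨M.dual.production (M.letterAction b i) t', (length_dual_production _ _).trans ht, ?_⟩
    rw [← dual_production_append]
    exact mem_component_trans h3 (dual_production_mem_component _ _)

/-- Invertibility enters here: whatever the prefix, some input letter reaches `u` as the letter of
the desired step. -/
theorem exists_append_left_mem_component [Finite Q] (hi : M.Invertible) (hr : M.Reversible)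
    {u v : List Q} (h : v ∈ M.component u) (t : List Q) :
    ∃ t', t'.length = t.length ∧ t' ++ v ∈ M.component (t ++ u) := by
  induction reflTransGen_of_mem_component hr h with
  | refl => exact ⟨t, rfl, mem_component_self _⟩
  | @tail b c h1 h2 ih =>
    obtain ⟨i, rfl⟩ := h2
    obtain ⟨t', ht, h3⟩ := ih (mem_component_of_reflTransGen h1)
    obtain ⟨j, rfl⟩ := (letterAction_bijective hi t').surjective i
    refine ⟨M.dual.production j t', (length_dual_production _ _).trans ht, ?_⟩
    rw [← dual_production_append]
    exact mem_component_trans h3 (dual_production_mem_component _ _)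

theorem exists_snoc_mem_component [Finite Q] (hr : M.Reversible) {u v : List Q}
    (h : v ∈ M.component u) (x : Q) : ∃ y, v ++ [y] ∈ M.component (u ++ [x]) := by
  obtain ⟨t, ht, h⟩ := exists_append_right_mem_component hr h [x]
  obtain ⟨y, rfl⟩ := List.length_eq_one_iff.1 ht
  exact ⟨y, h⟩

theorem finite_component [Finite Q] (u : List Q) : (M.component u).Finite :=
  (List.finite_length_eq Q u.length).subset fun _ h => length_eq_of_mem_component h

theorem ncard_extensions_eq [Finite Q] (hr : M.Reversible) {u v : List Q}
    (h : v ∈ M.component u) (w : List Q) :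
    {y | v ++ [y] ∈ M.component w}.ncard = {y | u ++ [y] ∈ M.component w}.ncard := by
  induction reflTransGen_of_mem_component hr h with
  | refl => rfl
  | @tail a b h1 h2 ih =>
    obtain ⟨i, rfl⟩ := h2
    rw [← ih (mem_component_of_reflTransGen h1),
      ← Set.ncard_image_of_injective {y | a ++ [y] ∈ M.component w}
        (hr (M.letterAction a i)).injective]
    congr 1
    ext y
    obtain ⟨x, rfl⟩ := (hr (M.letterAction a i)).surjective y
    rw [(hr (M.letterAction a i)).injective.mem_set_image]
    have := dual_production_append (M := M) a [x] i
    change M.dual.production i a ++ M.dual.production (M.letterAction a i) [x] ∈ M.component w ↔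
      a ++ [x] ∈ M.component w
    rw [← this]
    exact ⟨fun h => mem_component_trans h (mem_component_symm (dual_production_mem_component _ _)),
      fun h => mem_component_trans h (dual_production_mem_component _ _)⟩

/-- Deleting the last letter maps the lower component to the upper one, with fibres of equal size by
`ncard_extensions_eq`. -/
theorem label_edge [Finite Q] (hr : M.Reversible) (u : List Q) (x : Q) :
    (M.edge u x).label = {y | u ++ [y] ∈ M.component (u ++ [x])}.ncard := by
  classical
  have hb := finite_component (M := M) (u ++ [x])
  have ht := finite_component (M := M) u
  have hsnoc : ∀ w ∈ M.component (u ++ [x]), ∃ v ∈ M.component u, ∃ y, w = v ++ [y] := by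
    intro w hw
    have hl := length_eq_of_mem_component hw
    rcases List.eq_nil_or_concat w with rfl | ⟨v, y, rfl⟩
    · simp at hl
    · refine ⟨v, left_mem_component (by simpa using hl) (by simpa using hw), y, by simp⟩
  have h1 := Finset.card_eq_sum_card_fiberwise (f := List.dropLast) (s := hb.toFinset)
    (t := ht.toFinset) (by
      intro w hw
      obtain ⟨v, hv, y, rfl⟩ := hsnoc w (by simpa using hw)
      simpa using hv)
  have h2 : ∀ v ∈ ht.toFinset, (hb.toFinset.filter fun w => w.dropLast = v).card =
      {y | u ++ [y] ∈ M.component (u ++ [x])}.ncard := by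
    intro v hv
    rw [← ncard_extensions_eq hr (by simpa using hv) (u ++ [x]),
      ← Set.ncard_image_of_injective _ (f := fun y => v ++ [y]) (fun a b h => by simpa using h),
      ← Set.ncard_coe_finset]
    congr 1
    ext w
    simp only [Finset.coe_filter, Set.Finite.mem_toFinset, Set.mem_ofPred_eq, Set.mem_image]
    constructor
    · rintro ⟨hw, rfl⟩
      obtain ⟨v, hv, y, rfl⟩ := hsnoc w hw
      exact ⟨y, by simpa using hw, by simp⟩
    · rintro ⟨y, hy, rfl⟩
      exact ⟨hy, by simp⟩
  rw [Finset.sum_congr rfl h2, Finset.sum_const, smul_eq_mul, ← Set.ncard_eq_toFinset_card _ hb,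
    ← Set.ncard_eq_toFinset_card _ ht] at h1
  have hpos : 0 < (M.component u).ncard := (Set.ncard_pos ht).2 ⟨u, mem_component_self u⟩
  change (M.component (u ++ [x])).ncard / (M.component u).ncard = _
  rw [h1, Nat.mul_div_cancel_left _ hpos]

/-! ### The level of the connection degree -/

theorem powerConnected_connectionDegree {d : ℕ} (hd : M.connectionDegree = d) :
    M.PowerConnected d := by
  by_contra hc
  -- Level 0 is always connected, so `d = 0` cannot arise as the supremum of an empty set.
  have h0 : M.PowerConnected 0 := by
    intro u v hu hv
    rw [List.length_eq_zero_iff] at hu hv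
    subst hu hv
    exact mem_component_self _
  have hd0 : d ≠ 0 := fun h => hc (h ▸ h0)
  have hle : M.connectionDegree ≤ ((d - 1 : ℕ) : ℕ∞) := by
    refine iSup₂_le fun n hn => ?_
    have h1 : (n : ℕ∞) ≤ M.connectionDegree := le_iSup₂ (f := fun (n : ℕ) _ => (n : ℕ∞)) n hn
    rw [hd] at h1
    have h1 : n ≤ d := by exact_mod_cast h1
    have h2 : n ≠ d := fun h => hc (h ▸ hn)
    exact_mod_cast (by omega : n ≤ d - 1)
  rw [hd] at hle
  have : d ≤ d - 1 := by exact_mod_cast hle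
  omega

/-- The word belongs to the lower component of the reduction edge. -/
def Reduced (M : MealyAutomaton Q S) (w : List Q) : Prop :=
  ∃ e : M.Edge, M.IsReductionEdge e ∧ w ∈ e.bot

theorem Reduced.of_mem_component {u v : List Q} (hu : M.Reduced u) (h : v ∈ M.component u) :
    M.Reduced v := by
  obtain ⟨e, he, hm⟩ := hu
  refine ⟨e, he, ?_⟩
  obtain ⟨a, x, -, -, hb⟩ := e.isEdge
  rw [hb] at hm ⊢
  exact mem_component_trans hm h

theorem reduced_snoc_iff {d : ℕ} (hd : M.connectionDegree = d) {u : List Q}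
    (hu : u.length = d) (x : Q) : M.Reduced (u ++ [x]) ↔ (M.edge u x).label = 2 := by
  constructor
  · rintro ⟨e, ⟨hs, hl⟩, hm⟩
    rw [← hl]
    obtain ⟨a, y, hlev, ht, hb⟩ := e.isEdge
    have hs : (e.level : ℕ∞) = M.connectionDegree := hs
    rw [hd] at hs
    have hs : e.level = d := by exact_mod_cast hs
    rw [hb] at hm
    have h1 : M.component (u ++ [x]) = e.bot := hb ▸ component_eq hm
    have h2 : M.component u = e.top :=
      ht ▸ component_eq (powerConnected_connectionDegree hd a u (hlev.trans hs) hu)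
    change (M.component (u ++ [x])).ncard / (M.component u).ncard = e.bot.ncard / e.top.ncard
    rw [h1, h2]
  · intro h
    refine ⟨M.edge u x, ⟨?_, h⟩, mem_component_self _⟩
    change (u.length : ℕ∞) = _
    rw [hu, hd]

/-- Two non-empty fibres of a three-element set have sizes 2 and 1; `b` is the element of the
singleton. -/
theorem exists_ncard_fiber_ne_two_iff {α : Type*} (hQ : Nat.card Q = 3) (f : Q → α) {x₀ x₁ : Q}
    (hne : f x₀ ≠ f x₁) (h : ∀ z, f z = f x₀ ∨ f z = f x₁) :
    ∃ b, ∀ y, {z | f z = f y}.ncard ≠ 2 ↔ y = b := by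
  classical
  have : Finite Q := Nat.finite_of_card_ne_zero (by omega)
  have hx : x₀ ≠ x₁ := fun h => hne (congrArg f h)
  obtain ⟨z₀, hz₀⟩ : ∃ z, z ∉ ({x₀, x₁} : Set Q) := by
    by_contra! hc
    have := Set.ncard_pair hx
    rw [Set.eq_univ_of_forall hc, Set.ncard_univ] at this
    omega
  simp only [Set.mem_insert_iff, Set.mem_singleton_iff, not_or] at hz₀
  have huniv : ({x₀, x₁, z₀} : Set Q) = Set.univ := by
    refine Set.eq_of_subset_of_ncard_le (Set.subset_univ _) ?_ (Set.toFinite _)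
    rw [Set.ncard_univ, hQ, Set.ncard_insert_of_notMem, Set.ncard_pair (Ne.symm hz₀.2)]
    simp [hx, Ne.symm hz₀.1]
  have hall : ∀ y, y = x₀ ∨ y = x₁ ∨ y = z₀ := fun y => by
    have : y ∈ ({x₀, x₁, z₀} : Set Q) := huniv ▸ Set.mem_univ y
    simpa using this
  have key : ∀ a b : Q, f a ≠ f b → a ≠ z₀ → f z₀ = f a → (∀ y, y = a ∨ y = b ∨ y = z₀) →
      ∀ y, {z | f z = f y}.ncard ≠ 2 ↔ y = b := by
    intro a b hab haz hz hy y
    have h1 : {z | f z = f a} = {a, z₀} := by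
      ext z
      rcases hy z with rfl | rfl | rfl
      · simp
      · simp only [Set.mem_ofPred_eq, Ne.symm hab, Set.mem_insert_iff, Set.mem_singleton_iff,
          false_iff, not_or]
        exact ⟨fun h => hab (h ▸ rfl), fun h => hab (by rw [h, hz])⟩
      · simp [hz]
    have h2 : {z | f z = f b} = {b} := by
      ext z
      rcases hy z with rfl | rfl | rfl
      · simp only [Set.mem_ofPred_eq, hab, Set.mem_singleton_iff, false_iff]
        exact fun h => hab (h ▸ rfl)
      · simp
      · simp only [Set.mem_ofPred_eq, hz, hab, Set.mem_singleton_iff, false_iff]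
        exact fun h => hab (by rw [← hz, h])
    rcases hy y with rfl | rfl | rfl
    · rw [h1, Set.ncard_pair haz]
      simp only [ne_eq, not_true_eq_false, false_iff]
      exact fun h => hab (h ▸ rfl)
    · simp [h2]
    · rw [hz, h1, Set.ncard_pair haz]
      simp only [ne_eq, not_true_eq_false, false_iff]
      exact fun h => hab (by rw [← hz, h])
  rcases h z₀ with hz | hz
  · exact ⟨x₁, key x₀ x₁ hne (Ne.symm hz₀.1) hz hall⟩
  · exact ⟨x₀, key x₁ x₀ (Ne.symm hne) (Ne.symm hz₀.2) hz fun y => by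
      rcases hall y with h | h | h <;> simp [h]⟩

/-- Level `d` has a single component, so both splitting edges are realised by letters appended to
the given `u`. The three letters split between two edges, hence as 2 and 1. -/
theorem exists_not_reduced_snoc_iff (hQ : Nat.card Q = 3) (hr : M.Reversible) {d : ℕ}
    (hd : M.connectionDegree = d) (hs : M.splittingEdges.ncard = 2) {u : List Q}
    (hu : u.length = d) : ∃ b, ∀ y, ¬ M.Reduced (u ++ [y]) ↔ y = b := by
  have : Finite Q := Nat.finite_of_card_ne_zero (by omega)
  have hconn := powerConnected_connectionDegree hd
  obtain ⟨e, e', hne, hee⟩ := Set.ncard_eq_two.1 hs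
  have hex : ∀ e ∈ M.splittingEdges, ∃ x, M.edge u x = e := by
    rintro ⟨l, t, b, a, y, rfl, rfl, rfl⟩ he
    have he : (a.length : ℕ∞) = M.connectionDegree := he
    rw [hd] at he
    have he : a.length = d := by exact_mod_cast he
    have hua := hconn a u he hu
    obtain ⟨x, hx⟩ := exists_snoc_mem_component hr hua y
    refine ⟨x, ?_⟩
    simp only [edge, Edge.mk.injEq]
    exact ⟨hu.trans he.symm, component_eq hua, component_eq hx⟩
  obtain ⟨x₀, rfl⟩ := hex e (hee ▸ Set.mem_insert _ _)
  obtain ⟨x₁, rfl⟩ := hex e' (hee ▸ Set.mem_insert_of_mem _ rfl)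
  obtain ⟨b, hb⟩ := exists_ncard_fiber_ne_two_iff hQ (M.edge u) hne fun z => by
    have : M.edge u z ∈ M.splittingEdges := by
      change (u.length : ℕ∞) = _
      rw [hu, hd]
    rw [hee] at this
    simpa using this
  refine ⟨b, fun y => ?_⟩
  rw [← hb, reduced_snoc_iff hd hu, label_edge hr]
  have : {z | u ++ [z] ∈ M.component (u ++ [y])} = {z | M.edge u z = M.edge u y} := by
    ext z
    simp only [edge, Set.mem_ofPred_eq, Edge.mk.injEq, true_and]
    exact ⟨component_eq, fun h => h ▸ mem_component_self _⟩
  rw [this]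

/-- The words over `Q` of length `d + 1` that are not in the lower component of the reduction edge
form the graph of a permutation of the words of length `d`. -/
structure SplitsAt (M : MealyAutomaton Q S) (d : ℕ) : Prop where
  card : Nat.card Q = 3
  pos : 0 < d
  right : ∀ u : List Q, u.length = d → ∃ b, ∀ y, ¬ M.Reduced (u ++ [y]) ↔ y = b
  left : ∀ u : List Q, u.length = d → ∃ b, ∀ y, ¬ M.Reduced (y :: u) ↔ y = b

/-- Uniqueness on the left follows from uniqueness on the right by counting: sending `u` to the last
`d` letters of its non-reduced extension is surjective on words of length `d`, hence injective. -/
theorem splitsAt (hQ : Nat.card Q = 3) (hi : M.Invertible) (hr : M.Reversible) {d : ℕ}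
    (hd : M.connectionDegree = d) (hpos : 0 < d) (hs : M.splittingEdges.ncard = 2) :
    M.SplitsAt d := by
  have : Finite Q := Nat.finite_of_card_ne_zero (by omega)
  have hconn := powerConnected_connectionDegree hd
  have hright := fun (u : List Q) (hu : u.length = d) =>
    exists_not_reduced_snoc_iff hQ hr hd hs hu
  refine ⟨hQ, hpos, hright, ?_⟩
  have := finite_words (Q := Q) d
  choose φ hφ using hright
  let β : {l : List Q // l.length = d} → {l : List Q // l.length = d} := fun u =>
    ⟨u.1.tail ++ [φ u.1 u.2], by simp [u.2]; omega⟩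
  have hβ : ∀ (z : Q) (w : List Q) (hw : w.length = d), ¬ M.Reduced (z :: w) →
      ∃ u, β u = ⟨w, hw⟩ ∧ u.1.head? = some z := by
    intro z w hw hz
    rcases List.eq_nil_or_concat w with rfl | ⟨a, y, rfl⟩
    · simp at hw; omega
    · have hl : (z :: a).length = d := by simpa using hw
      refine ⟨⟨z :: a, hl⟩, Subtype.ext ?_, rfl⟩
      have : y = φ (z :: a) hl := (hφ (z :: a) hl y).1 (by simpa using hz)
      simp [β, this]
  -- A non-reduced word `a :: s` exists; as `s` and `w` share a component, it can be moved to a word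
  -- `z :: w`, still non-reduced.
  have hex : ∀ w : List Q, w.length = d → ∃ z, ¬ M.Reduced (z :: w) := by
    intro w hw
    have h1 := (hφ w hw _).2 rfl
    obtain ⟨a, s, hs⟩ : ∃ a s, w ++ [φ w hw] = a :: s := by
      cases h : w ++ [φ w hw] with
      | nil => simp at h
      | cons a s => exact ⟨a, s, rfl⟩
    have hsl : s.length = d := by
      simpa [hw] using (congrArg List.length hs).symm
    rw [hs] at h1
    obtain ⟨t, ht, h2⟩ := exists_append_left_mem_component hi hr (hconn s w hsl hw) [a]
    obtain ⟨z, rfl⟩ := List.length_eq_one_iff.1 ht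
    exact ⟨z, fun h => h1 (h.of_mem_component (mem_component_symm h2))⟩
  have hsurj : Function.Surjective β := by
    rintro ⟨w, hw⟩
    obtain ⟨z, hz⟩ := hex w hw
    obtain ⟨u, hu, -⟩ := hβ z w hw hz
    exact ⟨u, hu⟩
  have hinj := Finite.injective_iff_surjective.2 hsurj
  intro w hw
  obtain ⟨b, hb⟩ := hex w hw
  refine ⟨b, fun y => ⟨fun hy => ?_, fun h => h ▸ hb⟩⟩
  obtain ⟨u, hu, hub⟩ := hβ b w hw hb
  obtain ⟨v, hv, hvy⟩ := hβ y w hw hy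
  obtain rfl := hinj (hu.trans hv.symm)
  exact Option.some_injective _ (hvy.symm.trans hub)

/-! ### Words all of whose factors of length `d + 1` are reduced -/

/-- All factors of length `d + 1` of the word belong to the lower component of the reduction
edge. -/
def Good (M : MealyAutomaton Q S) (d : ℕ) (w : List Q) : Prop :=
  ∀ k, k + (d + 1) ≤ w.length → M.Reduced ((w.drop k).take (d + 1))

variable {d : ℕ}

theorem Good.of_mem_component {u v : List Q} (hu : M.Good d u) (h : v ∈ M.component u) :
    M.Good d v := fun k hk =>
  (hu k (length_eq_of_mem_component h ▸ hk)).of_mem_component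
    (take_mem_component (drop_mem_component h k) _)

theorem good_of_length_le {w : List Q} (h : w.length ≤ d) : M.Good d w := fun k hk => by omega

theorem good_iff_reduced {w : List Q} (h : w.length = d + 1) : M.Good d w ↔ M.Reduced w := by
  constructor
  · intro hw
    have := hw 0 (by omega)
    rwa [List.drop_zero, List.take_of_length_le h.le] at this
  · intro hw k hk
    obtain rfl : k = 0 := by omega
    rwa [List.drop_zero, List.take_of_length_le h.le]

theorem Good.left {u v : List Q} (h : M.Good d (u ++ v)) : M.Good d u := by
  intro k hk
  have := h k (by simp; omega)
  rwa [List.drop_append_of_le_length (by omega),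
    List.take_append_of_le_length (by simp; omega)] at this

theorem Good.right {u v : List Q} (h : M.Good d (u ++ v)) : M.Good d v := by
  intro k hk
  have := h (u.length + k) (by simp; omega)
  rwa [List.drop_append, List.drop_of_length_le (by omega), Nat.add_sub_cancel_left,
    List.nil_append] at this

/-- The overlap `v` has length at least `d`, so no factor of length `d + 1` meets both `u` and `w`.
-/
theorem Good.glue {u v w : List Q} (h : M.Good d (u ++ v)) (h' : M.Good d (v ++ w))
    (hv : d ≤ v.length) : M.Good d (u ++ v ++ w) := by
  intro k hk
  by_cases hk' : k + (d + 1) ≤ (u ++ v).length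
  · rw [List.drop_append_of_le_length (by omega),
      List.take_append_of_le_length (by simp at hk' ⊢; omega)]
    exact h k hk'
  · simp only [List.length_append, not_le] at hk hk'
    obtain ⟨j, rfl⟩ : ∃ j, k = u.length + j := ⟨k - u.length, by omega⟩
    rw [List.append_assoc, List.drop_append, List.drop_of_length_le (by omega),
      Nat.add_sub_cancel_left, List.nil_append]
    exact h' j (by simp; omega)

/-- Goodness of a concatenation only depends on the factors around the junction. -/
theorem Good.append {u v p q : List Q} (hu : M.Good d u) (hv : M.Good d v) (hp : p <:+ u)
    (hq : q <+: v) (hpl : d ≤ p.length) (hql : d ≤ q.length) (hpq : M.Good d (p ++ q)) :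
    M.Good d (u ++ v) := by
  obtain ⟨a, rfl⟩ := hp
  obtain ⟨b, rfl⟩ := hq
  rw [← List.append_assoc]
  exact (hu.glue hpq hpl).glue hv hql

theorem Good.append_of_suffix {u v p : List Q} (hu : M.Good d u) (hp : p <:+ u)
    (hpl : d ≤ p.length) (hpq : M.Good d (p ++ v)) : M.Good d (u ++ v) := by
  obtain ⟨a, rfl⟩ := hp
  exact hu.glue hpq hpl

theorem Good.append_of_prefix {u v p : List Q} (hv : M.Good d v) (hp : p <+: v)
    (hpl : d ≤ p.length) (hpq : M.Good d (u ++ p)) : M.Good d (u ++ v) := by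
  obtain ⟨a, rfl⟩ := hp
  rw [← List.append_assoc]
  exact hpq.glue hv hpl

theorem Good.snoc_iff {s : List Q} (hs : M.Good d s) (hl : d ≤ s.length) (x : Q) :
    M.Good d (s ++ [x]) ↔ M.Reduced (s.drop (s.length - d) ++ [x]) := by
  have hlen : (s.drop (s.length - d)).length = d := by simp; omega
  rw [← good_iff_reduced (d := d) (by simp [hlen])]
  constructor
  · intro h
    rw [← List.take_append_drop (s.length - d) s, List.append_assoc] at h
    exact h.right
  · exact hs.append_of_suffix (List.drop_suffix _ _) hlen.ge

theorem Good.cons_iff {s : List Q} (hs : M.Good d s) (hl : d ≤ s.length) (x : Q) :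
    M.Good d (x :: s) ↔ M.Reduced (x :: s.take d) := by
  have hlen : (s.take d).length = d := by simp; omega
  rw [← good_iff_reduced (d := d) (by simp [hlen])]
  constructor
  · intro h
    rw [← List.take_append_drop d s] at h
    exact Good.left (u := x :: s.take d) h
  · exact fun h => hs.append_of_prefix (u := [x]) (List.take_prefix _ _) hlen.ge h

theorem SplitsAt.not_good_snoc_iff (H : M.SplitsAt d) {s : List Q} (hs : M.Good d s)
    (hl : d ≤ s.length) : ∃ b, ∀ y, ¬ M.Good d (s ++ [y]) ↔ y = b := by
  obtain ⟨b, hb⟩ := H.right (s.drop (s.length - d)) (by simp; omega)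
  exact ⟨b, fun y => by rw [hs.snoc_iff hl, hb]⟩

theorem SplitsAt.not_good_snoc (H : M.SplitsAt d) {s : List Q} (hs : M.Good d s) :
    ∃ b, ∀ y, ¬ M.Good d (s ++ [y]) → y = b := by
  by_cases hl : d ≤ s.length
  · obtain ⟨b, hb⟩ := H.not_good_snoc_iff hs hl
    exact ⟨b, fun y => (hb y).1⟩
  · have : Nonempty Q := (Nat.card_pos_iff.1 (by rw [H.card]; omega)).1
    -- Every one-letter extension of a word shorter than `d` is good, so any letter serves as `b`.
    exact ⟨Classical.arbitrary Q, fun y hy => absurd (good_of_length_le (by simp; omega)) hy⟩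

theorem SplitsAt.not_good_cons (H : M.SplitsAt d) {s : List Q} (hs : M.Good d s) :
    ∃ b, ∀ y, ¬ M.Good d (y :: s) → y = b := by
  by_cases hl : d ≤ s.length
  · obtain ⟨b, hb⟩ := H.left (s.take d) (by simp; omega)
    exact ⟨b, fun y => by rw [hs.cons_iff hl, hb]; exact id⟩
  · have : Nonempty Q := (Nat.card_pos_iff.1 (by rw [H.card]; omega)).1
    exact ⟨Classical.arbitrary Q, fun y hy => absurd (good_of_length_le (by simp; omega)) hy⟩

theorem exists_ne_ne (hQ : Nat.card Q = 3) (a b : Q) : ∃ c, c ≠ a ∧ c ≠ b := by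
  have : Finite Q := Nat.finite_of_card_ne_zero (by omega)
  by_contra! h
  have h1 : (Set.univ : Set Q) ⊆ {a, b} := fun c _ => by
    by_cases hc : c = a
    · exact Or.inl hc
    · exact Or.inr (h c hc)
  have h2 := Set.ncard_le_ncard h1 (Set.toFinite _)
  have h3 := Set.ncard_insert_le a {b}
  rw [Set.ncard_univ, hQ] at h2
  rw [Set.ncard_singleton] at h3
  omega

/-- At each stage the two words forbid at most one letter each, which leaves a third. -/
theorem SplitsAt.exists_good_append_right (H : M.SplitsAt d) (m : ℕ) {s t : List Q}
    (hs : M.Good d s) (ht : M.Good d t) :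
    ∃ c : List Q, c.length = m ∧ M.Good d (s ++ c) ∧ M.Good d (t ++ c) := by
  induction m generalizing s t with
  | zero => exact ⟨[], rfl, by simpa, by simpa⟩
  | succ m ih =>
    obtain ⟨a, ha⟩ := H.not_good_snoc hs
    obtain ⟨b, hb⟩ := H.not_good_snoc ht
    obtain ⟨x, hxa, hxb⟩ := exists_ne_ne H.card a b
    obtain ⟨c, hc, h1, h2⟩ := ih (not_imp_comm.1 (ha x) hxa) (not_imp_comm.1 (hb x) hxb)
    exact ⟨x :: c, by simp [hc], by simpa using h1, by simpa using h2⟩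

theorem SplitsAt.exists_good_append_left (H : M.SplitsAt d) (m : ℕ) {s t : List Q}
    (hs : M.Good d s) (ht : M.Good d t) :
    ∃ c : List Q, c.length = m ∧ M.Good d (c ++ s) ∧ M.Good d (c ++ t) := by
  induction m generalizing s t with
  | zero => exact ⟨[], rfl, by simpa, by simpa⟩
  | succ m ih =>
    obtain ⟨a, ha⟩ := H.not_good_cons hs
    obtain ⟨b, hb⟩ := H.not_good_cons ht
    obtain ⟨x, hxa, hxb⟩ := exists_ne_ne H.card a b
    obtain ⟨c, hc, h1, h2⟩ := ih (not_imp_comm.1 (ha x) hxa) (not_imp_comm.1 (hb x) hxb)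
    exact ⟨c ++ [x], by simp [hc], by simpa using h1, by simpa using h2⟩

theorem Good.isOrbital (hd : M.connectionDegree = d) {w : List Q} (hw : M.Good d w) :
    M.IsOrbital w := by
  have hpath : ∀ (w u : List Q), ∀ e ∈ M.pathFrom u w,
      ∃ a x, e = M.edge a x ∧ a ++ [x] <+: u ++ w := by
    intro w
    induction w with
    | nil => intro u e he; simp [pathFrom] at he
    | cons x w ih =>
      intro u e he
      rcases List.mem_cons.1 he with rfl | he
      · exact ⟨u, x, rfl, w, by simp⟩
      · obtain ⟨a, y, h1, h2⟩ := ih _ _ he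
        exact ⟨a, y, h1, by simpa using h2⟩
  intro e he hl
  obtain ⟨a, x, rfl, t, ht⟩ := hpath w [] e he
  rw [List.nil_append] at ht
  have hg : M.Good d (a ++ [x]) := Good.left (ht ▸ hw)
  rw [hd] at hl
  have hl : d ≤ a.length := by exact_mod_cast hl
  obtain ⟨e₂, he₂, hm⟩ := (hg.left.snoc_iff hl x).1 hg
  refine ⟨e₂, he₂, fun v hv => ⟨v.drop (a.length - d), ?_, List.drop_suffix _ _⟩⟩
  have h1 := drop_mem_component hv (a.length - d)
  rw [List.drop_append_of_le_length (by omega)] at h1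
  obtain ⟨b, y, -, -, hb⟩ := e₂.isEdge
  rw [hb] at hm ⊢
  exact mem_component_trans hm h1

/-! ### Strong connectivity of the graph of good words -/

/-- There is a good word that begins with `p` and ends with `q`. -/
def Reaches (M : MealyAutomaton Q S) (d : ℕ) (p q : List Q) : Prop :=
  ∃ t, M.Good d t ∧ p <+: t ∧ q <:+ t

theorem Reaches.trans {p q r : List Q} (hq : q.length = d) (h : M.Reaches d p q)
    (h' : M.Reaches d q r) : M.Reaches d p r := by
  obtain ⟨_, ht, hp, t, rfl⟩ := h
  obtain ⟨_, ht', ⟨t', rfl⟩, hr⟩ := h'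
  refine ⟨t ++ q ++ t', ht.glue ht' hq.ge, hp.trans (List.prefix_append _ _), ?_⟩
  rw [List.append_assoc]
  exact hr.trans (List.suffix_append _ _)

theorem reaches_refl {p : List Q} (hp : p.length = d) : M.Reaches d p p :=
  ⟨p, good_of_length_le hp.le, List.prefix_rfl, List.suffix_rfl⟩

theorem reaches_step (hd : 0 < d) {u : List Q} (hu : u.length = d) {y : Q}
    (h : M.Reduced (u ++ [y])) : M.Reaches d u (u.tail ++ [y]) := by
  refine ⟨u ++ [y], (good_iff_reduced (by simp [hu])).2 h, List.prefix_append _ _, ?_⟩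
  cases u with
  | nil => simp at hu; omega
  | cons a u => exact List.suffix_cons _ _

/-- A translation of `ZMod 3`. -/
theorem exists_injective_apply_eq (hQ : Nat.card Q = 3) {a b : Q} (hab : a ≠ b) :
    ∃ c : Q → Q, Function.Injective c ∧ (∀ y, c y ≠ y) ∧ c a = b := by
  have : Finite Q := Nat.finite_of_card_ne_zero (by omega)
  let e : Q ≃ ZMod 3 := (Finite.equivFinOfCardEq hQ)
  refine ⟨fun z => e.symm (e z + (e b - e a)), ?_, ?_, by simp⟩
  · intro x y h
    simpa using h
  · intro y h
    rw [Equiv.symm_apply_eq] at h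
    have : e b - e a = 0 := by simpa using h
    exact hab (e.injective (sub_eq_zero.1 this)).symm

/-- Every good edge of the shift graph lies on a cycle of good edges. Composing the forbidden letter
with a fixed-point-free permutation `c` of the letters selects one good edge out of each word. By
left uniqueness this defines a permutation `σ`, and `c` is chosen so that `σ` uses the given edge.
-/
theorem SplitsAt.reaches_back (H : M.SplitsAt d) {u : List Q} (hu : u.length = d) {y : Q}
    (h : M.Reduced (u ++ [y])) : M.Reaches d (u.tail ++ [y]) u := by
  have : Finite Q := Nat.finite_of_card_ne_zero (by rw [H.card]; omega)
  have := finite_words (Q := Q) d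
  choose φ hφ using H.right
  have hne : φ u hu ≠ y := fun h' => (hφ u hu y).2 h'.symm h
  obtain ⟨c, hc, hcy, rfl⟩ := exists_injective_apply_eq H.card hne
  let σ : {l : List Q // l.length = d} → {l : List Q // l.length = d} := fun u =>
    ⟨u.1.tail ++ [c (φ u.1 u.2)], by have := H.pos; simp [u.2]; omega⟩
  have hstep : ∀ u, M.Reaches d u.1 (σ u).1 := fun u =>
    reaches_step H.pos u.2 (not_imp_comm.1 (hφ u.1 u.2 _).1 (hcy _))
  have hσ : Function.Injective σ := by
    rintro ⟨u, hu⟩ ⟨v, hv⟩ h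
    obtain ⟨h1, h2⟩ := List.append_inj' (congrArg Subtype.val h) rfl
    have h2 := hc (List.singleton_inj.1 h2)
    have h3 := (hφ u hu _).2 rfl
    have h4 := (hφ v hv _).2 rfl
    rw [← h2] at h4
    have hpos := H.pos
    cases u with
    | nil => simp at hu; omega
    | cons a u =>
      cases v with
      | nil => simp at hv; omega
      | cons b v =>
        obtain rfl : u = v := h1
        obtain ⟨z, hz⟩ := H.left (u ++ [φ (a :: u) hu]) (by simpa using hu)
        obtain rfl : a = b := ((hz a).1 h3).trans ((hz b).1 h4).symm
        rfl
  have hiter : ∀ (n : ℕ) (v), M.Reaches d v.1 (σ^[n] v).1 := by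
    intro n
    induction n with
    | zero => exact fun v => reaches_refl v.2
    | succ n ih => exact fun v => (hstep v).trans (σ v).2 (ih (σ v))
  obtain ⟨n, hn, hp⟩ := Function.mem_periodicPts.1 (hσ.mem_periodicPts ⟨u, hu⟩)
  have h1 := hiter (n - 1) (σ ⟨u, hu⟩)
  rw [← Function.iterate_succ_apply, Nat.succ_eq_add_one, Nat.sub_add_cancel hn, hp.eq] at h1
  exact h1

/-- A forbidden edge from `z :: u` to `u ++ [y]` is bypassed through another `z' :: u`: go forward
to a common successor `u ++ [x]`, back to `z' :: u`, then forward to `u ++ [y]`, which is allowed by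
left uniqueness. -/
theorem SplitsAt.reaches_shift (H : M.SplitsAt d) {u : List Q} (hu : u.length = d) (y : Q) :
    M.Reaches d u (u.tail ++ [y]) := by
  by_cases h : M.Reduced (u ++ [y])
  · exact reaches_step H.pos hu h
  have hpos := H.pos
  cases u with
  | nil => simp at hu; omega
  | cons z u =>
    obtain ⟨z', hz', -⟩ := exists_ne_ne H.card z z
    have hlen : ∀ (a : Q), (a :: u).length = d := fun a => by simpa using hu
    have hlen' : ∀ (a : Q), (u ++ [a]).length = d := fun a => by simpa using hu
    obtain ⟨b, hb⟩ := H.right (z :: u) (hlen z)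
    obtain ⟨b', hb'⟩ := H.right (z' :: u) (hlen z')
    obtain ⟨x, hx, hx'⟩ := exists_ne_ne H.card b b'
    obtain ⟨c, hc⟩ := H.left (u ++ [y]) (hlen' y)
    have h1 : M.Reduced ((z :: u) ++ [x]) := not_imp_comm.1 (hb x).1 hx
    have h2 : M.Reduced ((z' :: u) ++ [x]) := not_imp_comm.1 (hb' x).1 hx'
    have h3 : M.Reduced ((z' :: u) ++ [y]) :=
      not_imp_comm.1 (hc z').1 fun h' => hz' (h'.trans ((hc z).1 h).symm)
    exact (reaches_step H.pos (hlen z) h1).trans (hlen' x)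
      ((H.reaches_back (hlen z') h2).trans (hlen z') (reaches_step H.pos (hlen z') h3))

theorem SplitsAt.reaches (H : M.SplitsAt d) {p q : List Q} (hp : p.length = d)
    (hq : q.length = d) : M.Reaches d p q := by
  -- The letters of `q` are shifted in one at a time.
  have key : ∀ (q p : List Q), p.length = d → M.Reaches d p ((p ++ q).drop q.length) := by
    intro q
    induction q with
    | nil => intro p hp; simpa using reaches_refl hp
    | cons y q ih =>
      intro p hp
      have hpos := H.pos
      cases p with
      | nil => simp at hp; omega
      | cons a p =>
        have hl : (p ++ [y]).length = d := by simpa using hp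
        have := (H.reaches_shift hp y).trans hl (ih (p ++ [y]) hl)
        simpa using this
  have := key q p hp
  rwa [hq, List.drop_left' hp] at this

/-! ### Powers of words -/

theorem wordPow_zero (u : List Q) : wordPow u 0 = [] := rfl

theorem wordPow_succ (u : List Q) (k : ℕ) : wordPow u (k + 1) = u ++ wordPow u k := by
  simp [wordPow, List.replicate_succ]

theorem wordPow_add (u : List Q) (k l : ℕ) :
    wordPow u (k + l) = wordPow u k ++ wordPow u l := by
  rw [wordPow, List.replicate_add, List.flatten_append]
  rfl

theorem length_wordPow (u : List Q) (k : ℕ) : (wordPow u k).length = k * u.length := by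
  simp [wordPow]

theorem prefix_wordPow {u p : List Q} (h : p <+: u) {k : ℕ} (hk : 0 < k) : p <+: wordPow u k := by
  obtain ⟨k, rfl⟩ := Nat.exists_eq_succ_of_ne_zero hk.ne'
  rw [Nat.succ_eq_add_one, wordPow_succ]
  exact h.trans (List.prefix_append _ _)

theorem suffix_wordPow {u p : List Q} (h : p <:+ u) {k : ℕ} (hk : 0 < k) : p <:+ wordPow u k := by
  obtain ⟨k, rfl⟩ := Nat.exists_eq_succ_of_ne_zero hk.ne'
  rw [Nat.succ_eq_add_one, wordPow_add, wordPow_succ, wordPow_zero, List.append_nil]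
  exact h.trans (List.suffix_append _ _)

theorem Good.wordPow {u p q : List Q} (hu : M.Good d u) (hp : p <+: u) (hq : q <:+ u)
    (hpl : p.length = d) (hql : q.length = d) (h : M.Good d (q ++ p)) (k : ℕ) :
    M.Good d (wordPow u k) := by
  induction k with
  | zero => exact good_of_length_le (Nat.zero_le _)
  | succ k ih =>
    rcases Nat.eq_zero_or_pos k with rfl | hk
    · simpa [wordPow_succ, wordPow_zero] using hu
    · rw [wordPow_succ]
      exact hu.append ih hq (prefix_wordPow hp hk) hql.ge hpl.ge h

/-! ### Rigid levels -/

/-- The letter that follows a good word of length `n` is determined by the component of the extended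
word. -/
def RigidAt (M : MealyAutomaton Q S) (d n : ℕ) : Prop :=
  ∀ (u : List Q) (x y : Q), u.length = n → M.Good d (u ++ [x]) →
    u ++ [y] ∈ M.component (u ++ [x]) → x = y

theorem RigidAt.mono {n m : ℕ} (h : M.RigidAt d n) (hm : n ≤ m) : M.RigidAt d m := by
  intro u x y hu hg hc
  rw [← List.take_append_drop (m - n) u, List.append_assoc] at hg hc
  rw [List.append_assoc] at hc
  exact h (u.drop (m - n)) x y (by simp [hu]; omega) hg.right (right_mem_component rfl hc)

theorem RigidAt.append_eq {n : ℕ} (h : M.RigidAt d n) {s t t' : List Q} (hs : n ≤ s.length)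
    (hg : M.Good d (s ++ t)) (hc : s ++ t' ∈ M.component (s ++ t)) : t' = t := by
  induction t using List.reverseRecOn generalizing t' with
  | nil =>
    have := length_eq_of_mem_component hc
    simpa using this
  | append_singleton t x ih =>
    rcases List.eq_nil_or_concat t' with rfl | ⟨t', y, rfl⟩
    · have := length_eq_of_mem_component hc
      simp at this
    · rw [← List.append_assoc] at hg hc
      rw [List.concat_eq_append, ← List.append_assoc] at hc
      have hl : t'.length = t.length := by simpa using length_eq_of_mem_component hc
      obtain rfl := ih hg.left (left_mem_component (by simp [hl]) hc)
      rw [h.mono (m := (s ++ t').length) (by simp; omega) (s ++ t') x y rfl hg hc]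
      simp

/-- If no level is rigid, then the good words of each length form a single component. -/
theorem good_mem_component_of_not_rigid [Finite Q] (hr : M.Reversible) (H : M.SplitsAt d)
    (hconn : M.PowerConnected d) (hn : ∀ n, d ≤ n → ¬ M.RigidAt d n) (n : ℕ) (hdn : d ≤ n) :
    ∀ u v : List Q, u.length = n → v.length = n → M.Good d u → M.Good d v →
      v ∈ M.component u := by
  induction n, hdn using Nat.le_induction with
  | base => exact fun u v hu hv _ _ => hconn u v hu hv
  | succ n hdn ih =>
    have hrig := hn n hdn
    simp only [RigidAt, not_forall] at hrig
    -- Two good extensions of `u` share a component and the third letter gives a bad one, so every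
    -- good word of length `n + 1` can be moved into that component.
    obtain ⟨u, x, y, hu, hg, hc, hxy⟩ := hrig
    suffices h : ∀ w : List Q, w.length = n + 1 → M.Good d w → w ∈ M.component (u ++ [x]) from
      fun v w hv hw hgv hgw => mem_component_trans (mem_component_symm (h v hv hgv)) (h w hw hgw)
    intro w hw hgw
    rcases List.eq_nil_or_concat w with rfl | ⟨v, z, rfl⟩
    · simp at hw
    rw [List.concat_eq_append] at hw hgw ⊢
    obtain ⟨t, ht⟩ := exists_snoc_mem_component hr
      (ih v u (by simpa using hw) hu hgw.left hg.left) z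
    have hgt := hgw.of_mem_component ht
    obtain ⟨b, hb⟩ := H.not_good_snoc_iff hg.left (by omega)
    have hxb : x ≠ b := fun h => (hb x).2 h hg
    have hyb : y ≠ b := fun h => (hb y).2 h (hg.of_mem_component hc)
    have htb : t ≠ b := fun h => (hb t).2 h hgt
    have hcases : t = x ∨ t = y := by
      by_contra! hne
      have h4 : ({t, x, y, b} : Set Q).ncard = 4 := by
        rw [Set.ncard_insert_of_notMem (by simp [hne, htb]),
          Set.ncard_insert_of_notMem (by simp [hxy, hxb]), Set.ncard_pair hyb]
      have := Set.ncard_le_ncard (Set.subset_univ ({t, x, y, b} : Set Q)) (Set.toFinite _)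
      rw [h4, Set.ncard_univ, H.card] at this
      omega
    have htx : u ++ [t] ∈ M.component (u ++ [x]) := by
      rcases hcases with rfl | rfl
      · exact mem_component_self _
      · exact hc
    exact mem_component_trans htx (mem_component_symm ht)

theorem exists_rigidAt [Finite Q] (hr : M.Reversible) (H : M.SplitsAt d)
    (hconn : M.PowerConnected d) (hb : M.TwoBlocksBounded) : ∃ n, M.RigidAt d n := by
  by_contra! hn
  have hsingle := good_mem_component_of_not_rigid hr H hconn fun n _ => hn n
  have hlabel : ∀ (u : List Q) (x : Q), d ≤ u.length → M.Good d (u ++ [x]) →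
      (M.edge u x).label = 2 := by
    intro u x hu hg
    obtain ⟨b, hb⟩ := H.not_good_snoc_iff hg.left hu
    have : {y | u ++ [y] ∈ M.component (u ++ [x])} = {b}ᶜ := by
      ext y
      simp only [Set.mem_ofPred_eq, Set.mem_compl_iff, Set.mem_singleton_iff, ← hb, not_not]
      exact ⟨fun h => hg.of_mem_component h, fun h =>
        hsingle (u.length + 1) (by omega) _ _ (by simp) (by simp) hg h⟩
    rw [label_edge hr, this, Set.ncard_compl, Set.ncard_singleton, H.card]
  have hnil : M.Good d [] := good_of_length_le (Nat.zero_le _)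
  choose c hc using fun s : {s : List Q // M.Good d s} =>
    H.exists_good_append_right 1 s.2 s.2
  -- A branch through good words only; its labels are 2 from level `d` on.
  let f : ℕ → {s : List Q // M.Good d s} :=
    fun n => Nat.rec ⟨[], hnil⟩ (fun _ s => ⟨s.1 ++ c s, (hc s).2.1⟩) n
  have hf : ∀ n, (f (n + 1)).1 = (f n).1 ++ c (f n) := fun n => rfl
  have hfl : ∀ n, (f n).1.length = n := by
    intro n
    induction n with
    | zero => rfl
    | succ n ih => rw [hf, List.length_append, ih, (hc _).1]
  choose x hx using fun n => List.length_eq_one_iff.1 (hc (f n)).1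
  have hfx : ∀ n, (f (n + 1)).1 = (f n).1 ++ [x n] := fun n => by rw [hf, hx]
  obtain ⟨N, hN⟩ := hb
  have := hN (fun n => M.edge (f n).1 (x n)) (fun n => ⟨hfl n, by
    change M.component ((f n).1 ++ [x n]) = M.component (f (n + 1)).1
    rw [hfx]⟩) d ⊤ ⟨fun i hi _ => hlabel _ _ (by rw [hfl]; exact hi) (hfx i ▸ (f (i + 1)).2), ?_, ?_⟩
  · simp at this
  · intro hpos
    -- Level `d` is connected, so the preceding label is 3 and the infinite block starts exactly at
    -- `d`.
    have huniv : {y | (f (d - 1)).1 ++ [y] ∈ M.component ((f (d - 1)).1 ++ [x (d - 1)])} =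
        Set.univ :=
      Set.eq_univ_of_forall fun y => hconn _ _ (by simp [hfl]; omega) (by simp [hfl]; omega)
    change (M.edge (f (d - 1)).1 (x (d - 1))).label ≠ 2
    rw [label_edge hr, huniv, Set.ncard_univ, H.card]
    omega
  · intro q hq
    simp at hq

/-! ### Words of finite order -/

/-- A word all of whose powers are good acts with finite order when some level is rigid. -/
theorem RigidAt.exists_action_wordPow_eq_id [Finite Q] [Finite S] (hi : M.Invertible) {n : ℕ}
    (h : M.RigidAt d n) {w : List Q} (hw : w ≠ []) (hg : ∀ k, M.Good d (wordPow w k)) :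
    ∃ m, 0 < m ∧ M.action (wordPow w m) = id := by
  have := finite_words (Q := Q) n
  have huniq : ∀ k, n ≤ k → ∀ a ∈ M.component (wordPow w k), ∀ b ∈ M.component (wordPow w k),
      a.take n = b.take n → a = b := by
    intro k hk a ha b hb hab
    have hlen : (wordPow w k).length = k * w.length := length_wordPow w k
    have hpos : 0 < w.length := List.length_pos_iff.2 hw
    have hal := length_eq_of_mem_component ha
    have hn : n ≤ a.length := by
      rw [hal, hlen]
      exact hk.trans (Nat.le_mul_of_pos_right k hpos)
    have hga := (hg k).of_mem_component ha
    have hba := mem_component_trans (mem_component_symm ha) hb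
    rw [← List.take_append_drop n a] at hga hba ⊢
    rw [← List.take_append_drop n b, ← hab] at hba ⊢
    rw [h.append_eq (by simp [hn]) hga hba]
  -- The finite data of a component: for each prefix of length `n`, the induced map on letters. The
  -- exponent `n + k` ensures length at least `n`.
  let F : ℕ → Set ({l : List Q // l.length = n} × S × S) := fun k =>
    {p | ∃ a ∈ M.component (wordPow w (n + k)), a.take n = p.1.1 ∧ M.letterAction a p.2.1 = p.2.2}
  obtain ⟨k, l, hkl, hF⟩ : ∃ k l, k < l ∧ F k = F l := by
    obtain ⟨k, l, hne, hF⟩ := Finite.exists_ne_map_eq_of_infinite F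
    rcases lt_or_gt_of_ne hne with hlt | hlt
    · exact ⟨k, l, hlt, hF⟩
    · exact ⟨l, k, hlt, hF.symm⟩
  have key : ∀ s : List S, ∀ a ∈ M.component (wordPow w (n + k)),
      ∀ b ∈ M.component (wordPow w (n + l)), a.take n = b.take n →
        M.action a s = M.action b s := by
    intro s
    induction s with
    | nil => intro a _ b _ _; rw [action_nil, action_nil]
    | cons i s ih =>
      intro a ha b hb hab
      rw [action_cons, action_cons]
      have hal : n ≤ a.length := by
        rw [length_eq_of_mem_component ha, length_wordPow]
        exact (Nat.le_add_right n k).trans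
          (Nat.le_mul_of_pos_right _ (List.length_pos_iff.2 hw))
      have hbl : n ≤ b.length := by
        rw [length_eq_of_mem_component hb, length_wordPow]
        exact (Nat.le_add_right n l).trans
          (Nat.le_mul_of_pos_right _ (List.length_pos_iff.2 hw))
      have hmem : ((⟨a.take n, by simp [hal]⟩, i, M.letterAction a i) :
          {l : List Q // l.length = n} × S × S) ∈ F k := ⟨a, ha, rfl, rfl⟩
      rw [hF] at hmem
      obtain ⟨b', hb', h1, h2⟩ := hmem
      obtain rfl := huniq _ (Nat.le_add_right n l) b' hb' b hb (h1.trans hab)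
      rw [h2]
      congr 1
      refine ih _ (mem_component_trans ha (dual_production_mem_component a i)) _
        (mem_component_trans hb (dual_production_mem_component b' i)) ?_
      have htake : ∀ c : List Q, n ≤ c.length →
          (M.dual.production i c).take n = M.dual.production i (c.take n) := by
        intro c hc
        conv_lhs => rw [← List.take_append_drop n c, dual_production_append]
        exact List.take_left' (by simp [length_dual_production, hc])
      rw [htake a hal, htake b' hbl, hab]
  refine ⟨l - k, by omega, funext fun s => ?_⟩
  -- The actions of `w ^ (n + k)` and `w ^ (n + l)` agree, and surjectivity cancels the first
  -- factor.
  obtain ⟨s, rfl⟩ := action_surjective hi (wordPow w (n + k)) s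
  have h1 : wordPow w (n + l) = wordPow w (n + k) ++ wordPow w (l - k) := by
    rw [← wordPow_add]
    congr 1
    omega
  have hpre : (wordPow w (n + k)).take n = (wordPow w (n + l)).take n := by
    rw [h1, List.take_append_of_le_length]
    rw [length_wordPow]
    exact (Nat.le_add_right n k).trans (Nat.le_mul_of_pos_right _ (List.length_pos_iff.2 hw))
  have h2 := key s _ (mem_component_self _) _ (mem_component_self _) hpre
  rw [h1, action_append] at h2
  exact h2.symm

/-- Between two words of length `d` there is a word with trivial action. -/
theorem SplitsAt.exists_trivial_word [Finite Q] [Finite S] (hi : M.Invertible) (H : M.SplitsAt d)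
    {n : ℕ} (hn : M.RigidAt d n) {p q : List Q} (hp : p.length = d) (hq : q.length = d)
    (h : M.Good d (q ++ p)) :
    ∃ t, M.Good d t ∧ p <+: t ∧ q <:+ t ∧ M.action t = id := by
  obtain ⟨w, hw, hpw, hqw⟩ := H.reaches hp hq
  have hne : w ≠ [] := by
    rintro rfl
    have := H.pos
    rw [List.prefix_nil.1 hpw] at hp
    simp at hp
    omega
  have hg := hw.wordPow hpw hqw hp hq h
  obtain ⟨m, hm, hid⟩ := hn.exists_action_wordPow_eq_id hi hne hg
  exact ⟨wordPow w m, hg m, prefix_wordPow hpw hm, suffix_wordPow hqw hm, hid⟩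

/-- Each letter acts as a word that may be inserted between two occurrences of `q`. -/
theorem SplitsAt.exists_word_of_letter [Finite Q] [Finite S] (hi : M.Invertible)
    (H : M.SplitsAt d) {n : ℕ} (hn : M.RigidAt d n) {q : List Q} (hq : q.length = d) (y : Q) :
    ∃ v, v ≠ [] ∧ M.action v = M.action [y] ∧ M.Good d (q ++ v) ∧ q <:+ v := by
  have hpos := H.pos
  have hgq : M.Good d q := good_of_length_le hq.le
  have hgy : M.Good d [y] := good_of_length_le (by simp; omega)
  -- The word sought is `t y r`: `t` runs from `b` to `p` and `r` from `c` to `q`, both acting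
  -- trivially. The words `q b`, `p y c` make the junctions good, while `p b`, `q c` let `t` and `r`
  -- arise as powers.
  obtain ⟨b, hb, hqb, -⟩ := H.exists_good_append_right d hgq hgq
  obtain ⟨p, hp, hpb, hpy⟩ := H.exists_good_append_left d (good_of_length_le hb.le) hgy
  obtain ⟨c, hc, hpyc, hqc⟩ := H.exists_good_append_right d hpy hgq
  obtain ⟨t, ht, hbt, hpt, hidt⟩ := H.exists_trivial_word hi hn hb hp hpb
  obtain ⟨r, hr, hcr, hqr, hidr⟩ := H.exists_trivial_word hi hn hc hq hqc
  refine ⟨t ++ [y] ++ r, by simp, ?_, ?_, hqr.trans (List.suffix_append _ _)⟩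
  · rw [action_append, action_append, hidt, hidr]
    rfl
  · have h1 : M.Good d (q ++ t) := ht.append_of_prefix hbt hb.ge hqb
    have h2 : M.Good d (q ++ t ++ [y]) :=
      h1.append_of_suffix (hpt.trans (List.suffix_append _ _)) hp.ge hpy
    have h3 : p ++ [y] <:+ q ++ t ++ [y] := by
      obtain ⟨a, rfl⟩ := hpt
      exact ⟨q ++ a, by simp⟩
    have h4 := h2.append hr h3 hcr (by simp [hp]) hc.ge hpyc
    simpa using h4

/-- With one fixed `q` for all letters, each `V y` ends with `q` and may follow `q`, so the words `V
y` concatenate freely. A power of the image of `u` is the image of a power, hence good. -/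
theorem SplitsAt.exists_cyclically_good [Finite Q] [Finite S] (hi : M.Invertible)
    (H : M.SplitsAt d) {n : ℕ} (hn : M.RigidAt d n) {u : List Q} (hu : u ≠ []) :
    ∃ v, v ≠ [] ∧ (∀ k, M.Good d (wordPow v k)) ∧ M.action u = M.action v := by
  obtain ⟨x, -⟩ := List.exists_mem_of_ne_nil u hu
  have hq : (List.replicate d x).length = d := by simp
  -- Only the length of `q` matters.
  generalize List.replicate d x = q at hq
  choose V hne hact hgood hsuf using H.exists_word_of_letter hi hn hq
  have hgood' : ∀ (w X : List Q), M.Good d X → q <:+ X → M.Good d (X ++ w.flatMap V) := by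
    intro w
    induction w with
    | nil => intro X hX _; simpa using hX
    | cons y w ih =>
      intro X hX hqX
      rw [List.flatMap_cons, ← List.append_assoc]
      exact ih _ (hX.append_of_suffix hqX hq.ge (hgood y))
        ((hsuf y).trans (List.suffix_append _ _))
  have hact' : ∀ w : List Q, M.action (w.flatMap V) = M.action w := by
    intro w
    induction w with
    | nil => rfl
    | cons y w ih =>
      rw [List.flatMap_cons, action_append, ih, hact, ← action_append]
      rfl
  have hpow : ∀ k, wordPow (u.flatMap V) k = (wordPow u k).flatMap V := by
    intro k
    induction k with
    | zero => rfl
    | succ k ih => rw [wordPow_succ, wordPow_succ, List.flatMap_append, ih]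
  refine ⟨u.flatMap V, ?_, fun k => ?_, (hact' u).symm⟩
  · cases u with
    | nil => exact absurd rfl hu
    | cons y u => simp [hne y]
  · rw [hpow]
    exact (hgood' _ q (good_of_length_le hq.le) List.suffix_rfl).right

end MealyAutomaton

theorem mainTheorem3 :
    ∃ K : ℕ → ℕ, ∀ (Q : Type*) (S : Type*) [Finite Q] [Finite S] [Nonempty S]
      (M : MealyAutomaton Q S) (d : ℕ),
      Nat.card Q = 3 → M.Invertible → M.Reversible →
      M.connectionDegree = d → 0 < d → M.splittingEdges.ncard = 2 →
      M.TwoBlocksBounded →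
      ∀ u : List Q, u ≠ [] →
        ∃ k : ℕ, 0 < k ∧ k ≤ K d ∧
          ∃ v : List Q, v ≠ [] ∧ M.IsCyclicallyOrbital v ∧
            M.action (MealyAutomaton.wordPow u k) = M.action v := by
  refine ⟨fun _ => 1, ?_⟩
  intro Q S _ _ _ M d hQ hi hr hd hpos hs hb u hu
  have H := MealyAutomaton.splitsAt hQ hi hr hd hpos hs
  obtain ⟨n, hn⟩ := MealyAutomaton.exists_rigidAt hr H
    (MealyAutomaton.powerConnected_connectionDegree hd) hb
  obtain ⟨v, hv, hg, hact⟩ := H.exists_cyclically_good hi hn hu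
  refine ⟨1, one_pos, le_rfl, v, hv, fun k => (hg k).isOrbital hd, ?_⟩
  rw [← hact, MealyAutomaton.wordPow_succ, MealyAutomaton.wordPow_zero, List.append_nil]
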